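/- Let $\mathcal S$ be the real vector space of pairs $(\Phi,\Pi)$ of smooth real-valued functions on the circle $\mathbb S^1$, with the symplectic form $$\sigma\big((\Phi,\Pi),(\Phi',\Pi')\big)=\int_{-\pi}^{\pi}(\Phi'\,\Pi-\Phi\,\Pi')\,d\theta .$$ Let $\mathscr W$ be the Weyl algebra of $(\mathcal S,\sigma)$, i.e. the unital $C^*$-algebra (unique up to isomorphism) generated by nonzero elements $W(x)$, $x\in\mathcal S$, with $W(0)=\mathbf 1$, which satisfy the Weyl relations $W(-x)=W(x)^*$ and $W(x)W(y)=e^{i\sigma(x,y)/2}\,W(x+y)$. Let $\mathscr R$ be the set, partially ordered by inclusion, of open proper intervals of $\mathbb S^1$, i.e. of connected open sets $I\subset\mathbb S^1$ such that $I$ and $\mathrm{Int}(\mathbb S^1\setminus I)$ are nonempty. For $I\in\mathscr R$ let $\mathscr W(I)\subset\mathscr W$ be the $C^*$-subalgebra generated by the $W(\Phi,\Pi)$ with $\operatorname{supp}\Phi\subset I$ and $\operatorname{supp}\Pi\subset I$. The $\mathscr W(I)$ have a common unit and $\mathscr W(I)\subset\mathscr W(J)$ for $I\subset J$, so $\{\mathscr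 W(I)\}_{I\in\mathscr R}$ is a precosheaf of unital $C^*$-algebras (over an index set which is not directed). A unital $C^*$-algebra $\mathscr A$ is called a universal algebra of a precosheaf $\{\mathscr A(I)\}_{I}$ of $C^*$-algebras with common unit if 1. $\mathscr A$ contains every $\mathscr A(I)$ as a unital $C^*$-subalgebra, compatibly with the inclusions $\mathscr A(I)\subset\mathscr A(J)$ for $I\subset J$, and is generated as a $C^*$-algebra by all of them; 2. for every complex Hilbert space $\mathcal H$ and every family of representations $\pi_I:\mathscr A(I)\to\mathcal B(\mathcal H)$ ($*$-homomorphisms, not required to preserve the unit) such that $\pi_I|_{\mathscr A(J)}=\pi_J$ whenever $J\subset I$, there is a unique representation $\pi:\mathscr A\to\mathcal B(\mathcal H)$ with $\pi|_{\mathscr A(I)}=\pi_I$ for all $I$. **Proposition.** $\mathscr W$ is the universal algebra of $\{\mathscr W(I)\}_{I\in\mathscr R}$. -/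

import Mathlib

open scoped Manifold ContDiff

universe u v w

noncomputable section

/-! ## Cauchy data on the circle -/

/-- The real vector space of Cauchy data on the circle: pairs `(Φ, Π)` of smooth real functions. -/
abbrev CauchyData : Type :=
  C^∞⟮𝓡 1, Circle; 𝓘(ℝ, ℝ), ℝ⟯ × C^∞⟮𝓡 1, Circle; 𝓘(ℝ, ℝ), ℝ⟯

lemma CauchyData.intervalIntegrable (f g : C^∞⟮𝓡 1, Circle; 𝓘(ℝ, ℝ), ℝ⟯) (a b : ℝ) :
    IntervalIntegrable (fun θ : ℝ => f (Circle.exp θ) * g (Circle.exp θ))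
      MeasureTheory.volume a b := by
  have hf : Continuous f := f.contMDiff.continuous
  have hg : Continuous g := g.contMDiff.continuous
  have he : Continuous (fun θ : ℝ => Circle.exp θ) := Circle.exp.continuous
  exact ((hf.comp he).mul (hg.comp he)).intervalIntegrable a b

/-- The symplectic form `σ((Φ, Π), (Φ', Π')) = ∫ (Φ' Π - Φ Π') dθ`, with `θ ∈ [-π, π]` the angular
coordinate `θ ↦ exp (i θ)` of the circle. -/
def symplecticForm : LinearMap.BilinForm ℝ CauchyData :=
  LinearMap.mk₂ ℝ
    (fun x y => ∫ θ in (-Real.pi)..Real.pi,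
      (y.1 (Circle.exp θ) * x.2 (Circle.exp θ) - x.1 (Circle.exp θ) * y.2 (Circle.exp θ)))
    (by
      intro x x' y
      rw [← intervalIntegral.integral_add]
      · congr 1; funext θ; simp; ring
      all_goals
        exact (CauchyData.intervalIntegrable _ _ _ _).sub (CauchyData.intervalIntegrable _ _ _ _))
    (by
      intro c x y
      rw [smul_eq_mul, ← intervalIntegral.integral_const_mul]
      congr 1; funext θ; simp; ring)
    (by
      intro x y y'
      rw [← intervalIntegral.integral_add]
      · congr 1; funext θ; simp; ring
      all_goals
        exact (CauchyData.intervalIntegrable _ _ _ _).sub (CauchyData.intervalIntegrable _ _ _ _))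
    (by
      intro c x y
      rw [smul_eq_mul, ← intervalIntegral.integral_const_mul]
      congr 1; funext θ; simp; ring)

/-! ## Proper intervals -/

/-- A proper interval of the circle: a connected subset such that it and its complement both have
nonempty interior. -/
def IsProperInterval (I : Set Circle) : Prop :=
  IsConnected I ∧ (interior I).Nonempty ∧ (interior Iᶜ).Nonempty

/-- The set of open proper intervals of the circle, partially ordered by inclusion. -/
abbrev OpenProperInterval : Type := {I : Set Circle // IsOpen I ∧ IsProperInterval I}

/-- The subspace of the Cauchy data whose (closed) supports are contained in `I`. -/
def localData (I : OpenProperInterval) : Submodule ℝ CauchyData where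
  carrier := {x | tsupport x.1 ⊆ I.1 ∧ tsupport x.2 ⊆ I.1}
  zero_mem' := by
    constructor <;> simp [tsupport]
  add_mem' := by
    intro x y hx hy
    exact ⟨(tsupport_add (x.1 : Circle → ℝ) y.1).trans (Set.union_subset hx.1 hy.1),
      (tsupport_add (x.2 : Circle → ℝ) y.2).trans (Set.union_subset hx.2 hy.2)⟩
  smul_mem' := by
    intro c x hx
    exact ⟨(tsupport_smul_subset_right (fun _ => c) (x.1 : Circle → ℝ)).trans hx.1,
      (tsupport_smul_subset_right (fun _ => c) (x.2 : Circle → ℝ)).trans hx.2⟩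

/-! ## Weyl algebras -/

/-- `A`, together with the generators `W`, is the Weyl algebra of `(V, σ)`: the unital C*-algebra
generated by nonvanishing elements `W x` which satisfy the Weyl relations. The condition
`W 0 = 1` says that the unit of `A` is that of the algebra generated by the `W x`. -/
structure IsWeylAlgebra {V : Type w} [AddCommGroup V] [Module ℝ V] (σ : LinearMap.BilinForm ℝ V)
    {A : Type u} [CStarAlgebra A] (W : V → A) : Prop where
  ne_zero : ∀ x, W x ≠ 0
  map_zero : W 0 = 1
  map_neg : ∀ x, W (-x) = star (W x)
  mul : ∀ x y, W x * W y = Complex.exp (Complex.I * (σ x y : ℂ) / 2) • W (x + y)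
  generates : (StarAlgebra.adjoin ℂ (Set.range W)).topologicalClosure = ⊤

/-- The C*-subalgebra `𝒲(I)` generated by the `W (Φ, Π)` with `(Φ, Π)` supported in `I`. -/
def localWeylAlgebra {A : Type u} [CStarAlgebra A] (W : CauchyData → A) (I : OpenProperInterval) :
    StarSubalgebra ℂ A :=
  (StarAlgebra.adjoin ℂ (W '' (localData I : Set CauchyData))).topologicalClosure

lemma localWeylAlgebra_isClosed {A : Type u} [CStarAlgebra A] (W : CauchyData → A)
    (I : OpenProperInterval) : IsClosed (localWeylAlgebra W I : Set A) :=
  StarSubalgebra.isClosed_topologicalClosure _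

lemma localWeylAlgebra_mono {A : Type u} [CStarAlgebra A] (W : CauchyData → A) :
    Monotone (localWeylAlgebra W) := by
  intro I J h
  refine StarSubalgebra.topologicalClosure_mono (StarAlgebra.adjoin_mono (Set.image_mono ?_))
  exact fun x hx => ⟨hx.1.trans h, hx.2.trans h⟩

/-! ## Precosheaves of C*-algebras and universal algebras -/

/-- A precosheaf of unital C*-algebras with common unit over a partially ordered set: the inclusion
`𝒜(i) ⊆ 𝒜(j)`, for `i ≤ j`, is given by an injective unital *-homomorphism. -/
structure CStarPrecosheaf (ι : Type w) [PartialOrder ι] where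
  alg : ι → Type u
  cstar : ∀ i, CStarAlgebra (alg i)
  incl : ∀ {i j : ι}, i ≤ j → (alg i →⋆ₐ[ℂ] alg j)
  incl_injective : ∀ {i j : ι} (h : i ≤ j), Function.Injective (incl h)
  incl_refl : ∀ (i : ι) (a : alg i), incl (le_refl i) a = a
  incl_incl : ∀ {i j k : ι} (hij : i ≤ j) (hjk : j ≤ k) (a : alg i),
    incl hjk (incl hij a) = incl (hij.trans hjk) a

attribute [instance] CStarPrecosheaf.cstar

/-- `A`, with the embeddings `emb i : 𝒜(i) → A`, is the universal algebra of the precosheaf `𝒜`.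
A representation on a Hilbert space `H` is a *-homomorphism into the bounded operators on `H`, not
required to preserve the unit. -/
structure IsUniversalAlgebra {ι : Type w} [PartialOrder ι] (F : CStarPrecosheaf.{u} ι)
    {A : Type u} [CStarAlgebra A] (emb : ∀ i, F.alg i →⋆ₐ[ℂ] A) : Prop where
  emb_injective : ∀ i, Function.Injective (emb i)
  emb_incl : ∀ {i j : ι} (h : i ≤ j) (a : F.alg i), emb j (F.incl h a) = emb i a
  generates : (StarAlgebra.adjoin ℂ (⋃ i, Set.range (emb i))).topologicalClosure = ⊤
  existsUnique_rep : ∀ (H : Type v) [NormedAddCommGroup H] [InnerProductSpace ℂ H]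
    [CompleteSpace H] (ρ : ∀ i, F.alg i →⋆ₙₐ[ℂ] (H →L[ℂ] H)),
    (∀ {i j : ι} (h : i ≤ j) (a : F.alg i), ρ j (F.incl h a) = ρ i a) →
    ∃! π : A →⋆ₙₐ[ℂ] (H →L[ℂ] H), ∀ i (a : F.alg i), π (emb i a) = ρ i a

/-- A monotone family of C*-subalgebras of a unital C*-algebra, all of them containing its unit, as
a precosheaf. -/
def CStarPrecosheaf.ofSubalgebras {ι : Type w} [PartialOrder ι] {A : Type u} [CStarAlgebra A]
    (S : ι → StarSubalgebra ℂ A) (hS : ∀ i, IsClosed (S i : Set A)) (hmono : Monotone S) :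
    CStarPrecosheaf.{u} ι where
  alg i := S i
  cstar i := StarSubalgebra.cstarAlgebra (S i) (h_closed := hS i)
  incl h := StarSubalgebra.inclusion (hmono h)
  incl_injective _ := StarSubalgebra.inclusion_injective _
  incl_refl _ _ := rfl
  incl_incl _ _ _ := rfl

/-- The inclusions of the members of a monotone family of C*-subalgebras into the whole algebra. -/
def CStarPrecosheaf.ofSubalgebrasEmb {ι : Type w} [PartialOrder ι] {A : Type u} [CStarAlgebra A]
    (S : ι → StarSubalgebra ℂ A) (hS : ∀ i, IsClosed (S i : Set A)) (hmono : Monotone S) (i : ι) :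
    (CStarPrecosheaf.ofSubalgebras S hS hmono).alg i →⋆ₐ[ℂ] A :=
  (S i).subtype

/-- The precosheaf `{𝒲(I)}` of local Weyl algebras over the open proper intervals. -/
def weylPrecosheaf {A : Type u} [CStarAlgebra A] (W : CauchyData → A) :
    CStarPrecosheaf.{u} OpenProperInterval :=
  CStarPrecosheaf.ofSubalgebras (localWeylAlgebra W) (localWeylAlgebra_isClosed W)
    (localWeylAlgebra_mono W)

/-- The inclusion of `𝒲(I)` into `𝒲`. -/
def weylEmbedding {A : Type u} [CStarAlgebra A] (W : CauchyData → A) (I : OpenProperInterval) :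
    (weylPrecosheaf W).alg I →⋆ₐ[ℂ] A :=
  CStarPrecosheaf.ofSubalgebrasEmb (localWeylAlgebra W) (localWeylAlgebra_isClosed W)
    (localWeylAlgebra_mono W) I

/-! ## Existence of the Weyl algebra

The Weyl algebra is realized on `ℓ²(V)` by `(W x f) y = exp (i σ(x, y) / 2) f (y - x)`. -/

namespace WeylModel

variable {V : Type w} [AddCommGroup V] [Module ℝ V] (σ : LinearMap.BilinForm ℝ V)

/-- The Hilbert space `ℓ²(V)`. -/
abbrev Space (V : Type w) : Type w := lp (fun _ : V => ℂ) 2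

lemma norm_phase (r : ℝ) : ‖Complex.exp (Complex.I * (r : ℂ) / 2)‖ = 1 := by
  have : Complex.I * (r : ℂ) / 2 = ((r / 2 : ℝ) : ℂ) * Complex.I := by push_cast; ring
  rw [this, Complex.norm_exp_ofReal_mul_I]

/-- The function `y ↦ exp (i σ(x, y) / 2) f (y - x)`. -/
def shiftFun (x : V) (f : V → ℂ) (y : V) : ℂ :=
  Complex.exp (Complex.I * (σ x y : ℂ) / 2) * f (y - x)

lemma norm_shiftFun (x : V) (f : V → ℂ) (y : V) : ‖shiftFun σ x f y‖ = ‖f (y - x)‖ := by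
  rw [shiftFun, norm_mul, norm_phase, one_mul]

lemma memlp_shiftFun (x : V) (f : Space V) : Memℓp (shiftFun σ x f) 2 := by
  have h := (memℓp_gen_iff (by norm_num)).1 (lp.memℓp f)
  refine (memℓp_gen_iff (by norm_num)).2 ?_
  simp only [norm_shiftFun]
  exact (Equiv.subRight x).summable_iff.2 h

/-- The isometry `W x` of `ℓ²(V)`. -/
def shift (x : V) : Space V →ₗᵢ[ℂ] Space V where
  toFun f := ⟨shiftFun σ x f, memlp_shiftFun σ x f⟩
  map_add' f g := by
    ext y; exact mul_add _ _ _
  map_smul' c f := by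
    ext y; exact mul_left_comm _ _ _
  norm_map' f := by
    rw [lp.norm_eq_tsum_rpow (by norm_num), lp.norm_eq_tsum_rpow (by norm_num)]
    congr 1
    simp only [LinearMap.coe_mk, AddHom.coe_mk, norm_shiftFun]
    exact (Equiv.subRight x).tsum_eq (fun y => ‖f y‖ ^ (2 : ENNReal).toReal)

lemma shift_apply (x : V) (f : Space V) (y : V) :
    shift σ x f y = Complex.exp (Complex.I * (σ x y : ℂ) / 2) * f (y - x) := rfl

/-- The operator `W x` of `ℓ²(V)`. -/
def op (x : V) : Space V →L[ℂ] Space V := (shift σ x).toContinuousLinearMap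

lemma op_zero : op σ (0 : V) = 1 := by
  ext f y
  simp [op, shift_apply]

lemma op_mul (hσ : σ.IsAlt) (x y : V) :
    op σ x * op σ y = Complex.exp (Complex.I * (σ x y : ℂ) / 2) • op σ (x + y) := by
  ext f z
  have hxy : σ y x = -σ x y := (hσ.neg_eq x y).symm
  simp only [op, mul_apply_eq_comp, smul_apply,
    LinearIsometry.coe_toContinuousLinearMap, lp.coeFn_smul, Pi.smul_apply, shift_apply,
    smul_eq_mul, ← mul_assoc, ← Complex.exp_add, sub_sub]
  congr 2
  simp only [map_add, map_sub, LinearMap.add_apply, hxy]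
  push_cast
  ring

lemma op_neg (hσ : σ.IsAlt) (x : V) : op σ (-x) = star (op σ x) := by
  rw [ContinuousLinearMap.star_eq_adjoint, ContinuousLinearMap.eq_adjoint_iff]
  intro f g
  have h1 : op σ x * op σ (-x) = 1 := by
    rw [op_mul σ hσ, add_neg_cancel, op_zero]
    have h2 : σ x x = 0 := hσ x
    simp [h2]
  calc inner ℂ (op σ (-x) f) g
      = inner ℂ (shift σ x (op σ (-x) f)) (shift σ x g) := ((shift σ x).inner_map_map _ _).symm
    _ = inner ℂ ((op σ x * op σ (-x)) f) (op σ x g) := rfl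
    _ = inner ℂ f (op σ x g) := by rw [h1]; rfl

lemma op_ne_zero (x : V) : op σ x ≠ 0 := by
  classical
  intro h
  have h1 : op σ x (lp.single 2 (0 : V) (1 : ℂ)) = 0 := by rw [h]; rfl
  have h2 : ‖shift σ x (lp.single 2 (0 : V) (1 : ℂ))‖ = 0 := by
    rw [show shift σ x (lp.single 2 (0 : V) (1 : ℂ)) = 0 from h1, norm_zero]
  rw [LinearIsometry.norm_map, lp.norm_single (by norm_num)] at h2
  simp at h2

/-- The C*-algebra generated by the operators `W x`. -/
def algebra : StarSubalgebra ℂ (Space V →L[ℂ] Space V) :=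
  (StarAlgebra.adjoin ℂ (Set.range (op σ))).topologicalClosure

instance instCStarAlgebra : CStarAlgebra (algebra σ) :=
  StarSubalgebra.cstarAlgebra (algebra σ)
    (h_closed := StarSubalgebra.isClosed_topologicalClosure _)

/-- The generators, as elements of the C*-algebra which they generate. -/
def gen (x : V) : algebra σ :=
  ⟨op σ x, StarSubalgebra.le_topologicalClosure _ (StarAlgebra.subset_adjoin ℂ _ ⟨x, rfl⟩)⟩

/-- The C*-algebra of an alternating form on a real vector space, generated by the operators
`W x` on `ℓ²(V)`, satisfies the definition of its Weyl algebra. -/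
theorem isWeylAlgebra (hσ : σ.IsAlt) : IsWeylAlgebra σ (gen σ) where
  ne_zero x h := op_ne_zero σ x (congrArg Subtype.val h)
  map_zero := Subtype.ext (op_zero σ)
  map_neg x := Subtype.ext (op_neg σ hσ x)
  mul x y := Subtype.ext (op_mul σ hσ x y)
  generates := by
    rw [eq_top_iff]
    intro a _
    have hmap : (StarAlgebra.adjoin ℂ (Set.range (gen σ))).map (algebra σ).subtype =
        StarAlgebra.adjoin ℂ (Set.range (op σ)) := by
      rw [StarAlgHom.map_adjoin, ← Set.range_comp]
      rfl
    have ha : (a : Space V →L[ℂ] Space V) ∈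
        closure ((StarAlgebra.adjoin ℂ (Set.range (op σ)) :
          StarSubalgebra ℂ (Space V →L[ℂ] Space V)) : Set (Space V →L[ℂ] Space V)) := a.2
    rw [← hmap] at ha
    exact closure_subtype.2 ha

end WeylModel

lemma symplecticForm_isAlt : symplecticForm.IsAlt := by
  intro x
  simp [symplecticForm]

/-- The Weyl algebra of the Cauchy data on the circle exists. -/
theorem exists_isWeylAlgebra : ∃ (A : Type) (_ : CStarAlgebra A) (W : CauchyData → A),
    IsWeylAlgebra symplecticForm W :=
  ⟨_, _, _, WeylModel.isWeylAlgebra symplecticForm symplecticForm_isAlt⟩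

end

/-!
The Weyl algebra has a universal property of its own, and the local representations provide the
data to which it applies.

*Weyl systems extend.* A family `U x` in a C*-algebra satisfying the Weyl relations (with
`U 0` only a projection) is the image of the generators `W x` under a homomorphism, provided that
`σ` is nondegenerate. It has to be shown that `‖∑ c x • U x‖ ≤ ‖∑ c x • W x‖`. By nondegeneracy, the
unwanted terms of `∑ c x • W x` can be removed by averaging over conjugations with generators, so
every coefficient is bounded by the norm (`IsWeylAlgebra.norm_coeff_le`). Hence the wanted
inequality holds up to a factor, the number of terms. Applied to the powers `(a* a) ^ n`, the number
of terms of which grows only polynomially with `n`, this yields the inequality without a factor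
(`IsWeylAlgebra.norm_snd_le`). The homomorphism is then read off from the closure of the span of the
pairs `(W x, U x)`, which is a graph (`IsWeylAlgebra.exists_nonUnitalStarAlgHom`).

*Local representations define a global Weyl system.* For `x` supported in the proper intervals `I`
and `J`, the two local representations of `W x` coincide: by a partition of unity, `x` is a sum of
data supported in proper intervals contained in the possibly disconnected set `I ∩ J`
(`mem_iSup_localData`, `localRep_eq`). The circle is covered by three proper intervals any two of
which lie in a common proper interval, so that the local representations attached to them satisfy
the commutation relations with each other. A partition of unity subordinate to this cover decomposes
every `x` into three local pieces, and the product of the corresponding operators, with the right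
phase, is the global Weyl system (`exists_weylSystem_extending`).

The same decomposition shows that the local algebras generate the Weyl algebra, from which
uniqueness follows by continuity (`hom_ext_of_weylEmbedding`).
-/

noncomputable section

/-! ### Weyl systems -/

/-- A Weyl system of `(V, σ)` along a linear map `p : E → V`: the elements `U x` satisfy the Weyl
relations of the elements `W (p x)`. Neither `U 0 = 1` nor `U x ≠ 0` is required, so that `U 0` is
merely a projection. -/
structure IsWeylSystem {V E : Type*} [AddCommGroup V] [Module ℝ V] [AddCommGroup E] [Module ℝ E]
    (σ : LinearMap.BilinForm ℝ V) (p : E →ₗ[ℝ] V) {B : Type*} [Ring B] [StarRing B] [Algebra ℂ B]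
    (U : E → B) : Prop where
  map_neg : ∀ x, U (-x) = star (U x)
  mul : ∀ x y, U x * U y = Complex.exp (Complex.I * (σ (p x) (p y) : ℂ) / 2) • U (x + y)

section Algebra

variable {V E : Type*} [AddCommGroup V] [Module ℝ V] [AddCommGroup E] [Module ℝ E]
  {σ : LinearMap.BilinForm ℝ V} {B : Type*} [Ring B] [StarRing B] [Algebra ℂ B]

lemma IsWeylAlgebra.isWeylSystem {A : Type*} [CStarAlgebra A] {W : V → A}
    (hW : IsWeylAlgebra σ W) (p : E →ₗ[ℝ] V) : IsWeylSystem σ p (fun x => W (p x)) where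
  map_neg x := by simp only [_root_.map_neg, hW.map_neg]
  mul x y := by rw [hW.mul, map_add]

lemma IsWeylSystem.commute {p : E →ₗ[ℝ] V} {U : E → B} (hσ : σ.IsAlt) (hU : IsWeylSystem σ p U)
    (x y : E) :
    U x * U y = Complex.exp (Complex.I * (σ (p x) (p y) : ℂ)) • (U y * U x) := by
  rw [hU.mul, hU.mul, smul_smul, ← Complex.exp_add, add_comm y x,
    ← hσ.neg_eq (p x) (p y)]
  congr 2
  push_cast
  ring

/-- The elements `exp (-i σ(p x, q x) / 2) U x T x`, which form a Weyl system along `p + q` if `U`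
and `T` are Weyl systems along `p` and `q` with the commutation relations of the elements
`W (p x)` and `W (q y)`. -/
def weylGlue (σ : LinearMap.BilinForm ℝ V) (p q : E →ₗ[ℝ] V) (U T : E → B) (x : E) : B :=
  Complex.exp (-(Complex.I * (σ (p x) (q x) : ℂ) / 2)) • (U x * T x)

lemma IsWeylSystem.glue {p q : E →ₗ[ℝ] V} {U T : E → B} [StarModule ℂ B] (hσ : σ.IsAlt)
    (hU : IsWeylSystem σ p U)
    (hT : IsWeylSystem σ q T)
    (hUT : ∀ x y, U x * T y = Complex.exp (Complex.I * (σ (p x) (q y) : ℂ)) • (T y * U x)) :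
    IsWeylSystem σ (p + q) (weylGlue σ p q U T) where
  map_neg x := by
    rw [weylGlue, hUT (-x) (-x), weylGlue, hU.map_neg, hT.map_neg, star_smul, star_mul, smul_smul,
      ← Complex.exp_add, Complex.star_def, ← Complex.exp_conj]
    congr 2
    simp only [_root_.map_neg, LinearMap.neg_apply, neg_neg, map_mul, map_div₀, Complex.conj_I,
      Complex.conj_ofReal, Complex.conj_ofNat]
    ring
  mul x y := by
    have h : T x * U y = Complex.exp (-(Complex.I * (σ (p y) (q x) : ℂ))) • (U y * T x) := by
      rw [hUT, smul_smul, ← Complex.exp_add, neg_add_cancel, Complex.exp_zero, one_smul]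
    have h2 : (U x * T x) * (U y * T y) =
        Complex.exp (-(Complex.I * (σ (p y) (q x) : ℂ))) • ((U x * U y) * (T x * T y)) := by
      rw [mul_assoc, ← mul_assoc (T x), h, smul_mul_assoc, mul_smul_comm]
      simp only [mul_assoc]
    simp only [weylGlue]
    rw [smul_mul_smul_comm, h2, hU.mul, hT.mul, smul_mul_smul_comm]
    simp only [smul_smul, ← Complex.exp_add]
    congr 2
    have e : (σ (q x)) (p y) = -σ (p y) (q x) := (hσ.neg_eq _ _).symm
    simp only [map_add, LinearMap.add_apply, e]
    push_cast
    ring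

omit [StarRing B] in
/-- Gluing is compatible with the commutation relations with a third family. -/
lemma weylGlue_commute {p q r : E →ₗ[ℝ] V} {U T S : E → B}
    (hU : ∀ x y, U x * S y = Complex.exp (Complex.I * (σ (p x) (r y) : ℂ)) • (S y * U x))
    (hT : ∀ x y, T x * S y = Complex.exp (Complex.I * (σ (q x) (r y) : ℂ)) • (S y * T x))
    (x y : E) :
    weylGlue σ p q U T x * S y =
      Complex.exp (Complex.I * (σ ((p + q) x) (r y) : ℂ)) • (S y * weylGlue σ p q U T x) := by
  simp only [weylGlue]
  rw [smul_mul_assoc, mul_assoc, hT, mul_smul_comm, ← mul_assoc, hU, smul_mul_assoc, mul_assoc,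
    mul_smul_comm]
  simp only [smul_smul, ← Complex.exp_add]
  congr 2
  simp only [map_add, LinearMap.add_apply]
  push_cast
  ring

lemma IsWeylAlgebra.weylGlue {A : Type*} [CStarAlgebra A] {W : V → A} (hW : IsWeylAlgebra σ W)
    (p q : E →ₗ[ℝ] V) (x : E) :
    weylGlue σ p q (fun x => W (p x)) (fun x => W (q x)) x = W ((p + q) x) := by
  simp only [_root_.weylGlue]
  rw [hW.mul, smul_smul, ← Complex.exp_add, neg_add_cancel, Complex.exp_zero, one_smul]
  rfl

lemma IsWeylSystem.prod {p : E →ₗ[ℝ] V} {C : Type*} [Ring C] [StarRing C] [Algebra ℂ C]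
    {U : E → B} {T : E → C} (hU : IsWeylSystem σ p U) (hT : IsWeylSystem σ p T) :
    IsWeylSystem σ p (fun x => (U x, T x)) where
  map_neg x := Prod.ext (hU.map_neg x) (hT.map_neg x)
  mul x y := Prod.ext (hU.mul x y) (hT.mul x y)

open scoped Pointwise in
lemma IsWeylSystem.mul_mem_span [DecidableEq E] {p : E →ₗ[ℝ] V} {U : E → B}
    (hU : IsWeylSystem σ p U)
    {s t : Set E} {a b : B} (ha : a ∈ Submodule.span ℂ (U '' s))
    (hb : b ∈ Submodule.span ℂ (U '' t)) : a * b ∈ Submodule.span ℂ (U '' (s + t)) := by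
  have h := Submodule.mul_mem_mul ha hb
  rw [Submodule.span_mul_span] at h
  refine Submodule.span_le.2 ?_ h
  rintro _ ⟨_, ⟨x, hx, rfl⟩, _, ⟨y, hy, rfl⟩, rfl⟩
  change U x * U y ∈ _
  rw [hU.mul]
  exact Submodule.smul_mem _ _ (Submodule.subset_span ⟨_, Set.add_mem_add hx hy, rfl⟩)

open scoped Pointwise in
lemma IsWeylSystem.star_mem_span [StarModule ℂ B] {p : E →ₗ[ℝ] V} {U : E → B}
    (hU : IsWeylSystem σ p U) {s : Set E} {a : B} (ha : a ∈ Submodule.span ℂ (U '' s)) :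
    star a ∈ Submodule.span ℂ (U '' (-s)) := by
  induction ha using Submodule.span_induction with
  | mem a h =>
    obtain ⟨x, hx, rfl⟩ := h
    rw [← hU.map_neg]
    exact Submodule.subset_span ⟨_, Set.neg_mem_neg.2 hx, rfl⟩
  | zero => rw [star_zero]; exact Submodule.zero_mem _
  | add a b _ _ h h' => rw [star_add]; exact Submodule.add_mem _ h h'
  | smul c a _ h => rw [star_smul]; exact Submodule.smul_mem _ _ h

end Algebra

/-! ### Norm estimates for Weyl systems -/

section Norm

variable {V : Type*} [AddCommGroup V] [Module ℝ V] {σ : LinearMap.BilinForm ℝ V}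

lemma IsWeylAlgebra.mul_star_self {A : Type*} [CStarAlgebra A] {W : V → A} (hσ : σ.IsAlt)
    (hW : IsWeylAlgebra σ W) (x : V) : W x * star (W x) = 1 ∧ star (W x) * W x = 1 := by
  have h : σ x x = 0 := hσ x
  constructor <;> rw [← hW.map_neg, hW.mul] <;> simp [hW.map_zero, h]

lemma IsWeylAlgebra.norm_eq_one {A : Type*} [CStarAlgebra A] {W : V → A} (hσ : σ.IsAlt)
    (hW : IsWeylAlgebra σ W) (x : V) : ‖W x‖ = 1 := by
  have : Nontrivial A := ⟨W 0, 0, hW.ne_zero 0⟩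
  exact CStarRing.norm_of_mem_unitary
    (Unitary.mem_iff.2 ⟨(hW.mul_star_self hσ x).2, (hW.mul_star_self hσ x).1⟩)

/-- The elements of a Weyl system are partial isometries. -/
lemma IsWeylSystem.norm_le_one {E : Type*} [AddCommGroup E] [Module ℝ E] {p : E →ₗ[ℝ] V}
    {B : Type*} [CStarAlgebra B] {U : E → B} (hσ : σ.IsAlt)
    (hU : IsWeylSystem σ p U) (x : E) : ‖U x‖ ≤ 1 := by
  have key : ∀ x, star (U x) * U x = U 0 := by
    intro x
    have h : σ (p x) (p x) = 0 := hσ (p x)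
    rw [← hU.map_neg, hU.mul]
    simp [h]
  have h0 : ‖U 0‖ * ‖U 0‖ = ‖U 0‖ := by rw [← CStarRing.norm_star_mul_self, key]
  have h1 : ‖U x‖ * ‖U x‖ = ‖U 0‖ := by rw [← CStarRing.norm_star_mul_self, key]
  nlinarith [norm_nonneg (U x), sq_nonneg (‖U 0‖ - 1)]

/-- Conjugation with a generator multiplies each generator by a phase. -/
lemma IsWeylAlgebra.conj {A : Type*} [CStarAlgebra A] {W : V → A} (hσ : σ.IsAlt)
    (hW : IsWeylAlgebra σ W) (x y : V) :
    W y * W x * star (W y) = Complex.exp (Complex.I * (σ y x : ℂ)) • W x := by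
  have h := (hW.isWeylSystem LinearMap.id).commute hσ y x
  simp only [LinearMap.id_apply] at h
  rw [h, smul_mul_assoc, mul_assoc, (hW.mul_star_self hσ y).1, mul_one]

/-- The coefficients of a linear combination of the generators are bounded by its norm. The other
terms are removed one at a time: for `σ(y, x₁ - x₀) = π`, the average of `a` and of a multiple of
`W y a (W y)*` has the same `x₀`-term as `a` and no `x₁`-term. -/
lemma IsWeylAlgebra.norm_coeff_le {A : Type*} [CStarAlgebra A] {W : V → A} (hσ : σ.IsAlt)
    (hnd : ∀ x, x ≠ 0 → ∃ y, σ y x ≠ 0) (hW : IsWeylAlgebra σ W) (x₀ : V) (s : Finset V) :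
    x₀ ∉ s → ∀ (c₀ : ℂ) (c : V → ℂ), ‖c₀‖ ≤ ‖c₀ • W x₀ + ∑ x ∈ s, c x • W x‖ := by
  classical
  induction s using Finset.induction with
  | empty => intro _ c₀ c; simp [norm_smul, hW.norm_eq_one hσ]
  | insert x₁ s hx₁ ih =>
    intro h c₀ c
    rw [Finset.mem_insert, not_or] at h
    obtain ⟨y', hy'⟩ := hnd (x₁ - x₀) (sub_ne_zero.2 (Ne.symm h.1))
    obtain ⟨y, hy⟩ : ∃ y, σ y (x₁ - x₀) = Real.pi :=
      ⟨(Real.pi / σ y' (x₁ - x₀)) • y', by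
        simp only [map_smul, LinearMap.smul_apply, smul_eq_mul]
        field_simp⟩
    set a := c₀ • W x₀ + ∑ x ∈ insert x₁ s, c x • W x with ha
    -- The phase `l` undoes the effect of the conjugation on the `x₀`-term.
    set l := Complex.exp (-(Complex.I * (σ y x₀ : ℂ))) with hl
    have hl1 : ‖l‖ = 1 := by
      rw [hl, show -(Complex.I * (σ y x₀ : ℂ)) = ((-σ y x₀ : ℝ) : ℂ) * Complex.I by push_cast; ring,
        Complex.norm_exp_ofReal_mul_I]
    have hterm : ∀ x, l • (W y * W x * star (W y)) =
        Complex.exp (Complex.I * (σ y (x - x₀) : ℂ)) • W x := by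
      intro x
      rw [hW.conj hσ, smul_smul, hl, ← Complex.exp_add, map_sub]
      congr 2; push_cast; ring
    have hb : (1 / 2 : ℂ) • (a + l • (W y * a * star (W y))) = c₀ • W x₀ +
        ∑ x ∈ s,
          ((1 / 2 : ℂ) * (1 + Complex.exp (Complex.I * (σ y (x - x₀) : ℂ))) * c x) • W x := by
      have e : l • (W y * a * star (W y)) = c₀ • W x₀ +
          ∑ x ∈ insert x₁ s, (c x * Complex.exp (Complex.I * (σ y (x - x₀) : ℂ))) • W x := by
        rw [ha, mul_add, add_mul, Finset.mul_sum, Finset.sum_mul, smul_add, Finset.smul_sum]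
        simp only [mul_smul_comm, smul_mul_assoc, smul_comm l, hterm, smul_smul]
        simp
      have hpi : Complex.exp (Complex.I * (Real.pi : ℂ)) = -1 := by
        rw [mul_comm]; exact Complex.exp_pi_mul_I
      rw [e, ha, Finset.sum_insert hx₁, Finset.sum_insert hx₁, hy, hpi]
      have e2 : ∀ S T : A, (1 / 2 : ℂ) • (c₀ • W x₀ + (c x₁ • W x₁ + S) +
          (c₀ • W x₀ + ((c x₁ * -1) • W x₁ + T))) = c₀ • W x₀ + (1 / 2 : ℂ) • (S + T) := by
        intro S T; module
      rw [e2, ← Finset.sum_add_distrib, Finset.smul_sum]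
      congr 1
      refine Finset.sum_congr rfl fun x _ => ?_
      module
    calc ‖c₀‖ ≤ ‖(1 / 2 : ℂ) • (a + l • (W y * a * star (W y)))‖ := by
          rw [hb]; exact ih h.2 c₀ _
      _ ≤ 1 / 2 * (‖a‖ + ‖a‖) := by
          rw [norm_smul]
          have h3 : ‖W y * a * star (W y)‖ ≤ ‖a‖ := by
            calc _ ≤ ‖W y‖ * ‖a‖ * ‖star (W y)‖ :=
                  (norm_mul_le _ _).trans (by gcongr; exact norm_mul_le _ _)
              _ = ‖a‖ := by rw [norm_star, hW.norm_eq_one hσ]; ring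
          have h4 : ‖a + l • (W y * a * star (W y))‖ ≤ ‖a‖ + ‖a‖ := by
            refine (norm_add_le _ _).trans ?_
            rw [norm_smul, hl1, one_mul]; gcongr
          norm_num
          linarith
      _ = ‖a‖ := by ring

/-- The crude form of `IsWeylAlgebra.norm_snd_le`, with the number of terms as a factor: each
coefficient is bounded by the norm of the linear combination of the generators. -/
lemma IsWeylAlgebra.norm_snd_le_card_mul {A B : Type*} [CStarAlgebra A] [CStarAlgebra B]
    {W : V → A} {U : V → B} (hσ : σ.IsAlt) (hnd : ∀ x, x ≠ 0 → ∃ y, σ y x ≠ 0)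
    (hW : IsWeylAlgebra σ W) (hU : IsWeylSystem σ LinearMap.id U) (s : Finset V) {a : A × B}
    (ha : a ∈ Submodule.span ℂ ((fun x => (W x, U x)) '' (s : Set V))) :
    ‖a.2‖ ≤ s.card * ‖a.1‖ := by
  classical
  obtain ⟨c', hc'⟩ := (Submodule.mem_span_image_finset_iff_exists_fun ℂ).1 ha
  obtain ⟨c, rfl⟩ : ∃ c : V → ℂ, ∑ x ∈ s, c x • ((W x, U x) : A × B) = a := by
    refine ⟨Function.extend Subtype.val c' 0, ?_⟩
    rw [← hc', ← Finset.sum_coe_sort]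
    simp only [Subtype.val_injective.extend_apply]
  simp only [Prod.smul_mk, Prod.fst_sum, Prod.snd_sum]
  calc ‖∑ x ∈ s, c x • U x‖ ≤ ∑ x ∈ s, ‖c x • U x‖ := norm_sum_le _ _
    _ ≤ ∑ x ∈ s, ‖∑ x ∈ s, c x • W x‖ := by
        refine Finset.sum_le_sum fun x hx => ?_
        have h1 : ‖c x • U x‖ ≤ ‖c x‖ := by
          rw [norm_smul]
          exact mul_le_of_le_one_right (norm_nonneg _) (hU.norm_le_one hσ x)
        refine h1.trans ?_
        rw [← Finset.add_sum_erase s _ hx]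
        exact hW.norm_coeff_le hσ hnd x (s.erase x) (Finset.notMem_erase _ _) _ _
    _ = _ := by rw [Finset.sum_const, nsmul_eq_mul]

/-- The sums `∑ m x • x`, with `x ∈ s` and `0 ≤ m x ≤ n`. This set contains the `n`-fold sumset of
`s`, and its cardinality is at most polynomial in `n`. -/
def sumBox [DecidableEq V] (s : Finset V) (n : ℕ) : Finset V :=
  (Fintype.piFinset fun _ : s => Finset.range (n + 1)).image fun m => ∑ x : s, m x • (x : V)

omit [Module ℝ V] in
lemma card_sumBox_le [DecidableEq V] (s : Finset V) (n : ℕ) :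
    (sumBox s n).card ≤ (n + 1) ^ s.card := by
  refine Finset.card_image_le.trans ?_
  simp

omit [Module ℝ V] in
lemma add_mem_sumBox [DecidableEq V] {s : Finset V} {n : ℕ} {x y : V} (hx : x ∈ sumBox s n)
    (hy : y ∈ s) : x + y ∈ sumBox s (n + 1) := by
  simp only [sumBox, Finset.mem_image, Fintype.mem_piFinset, Finset.mem_range] at hx ⊢
  obtain ⟨m, hm, rfl⟩ := hx
  refine ⟨m + Pi.single ⟨y, hy⟩ 1, fun z => ?_, ?_⟩
  · have := hm z
    by_cases h : z = ⟨y, hy⟩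
    · subst h; simp; omega
    · simp [h]; omega
  · simp only [Pi.add_apply, add_smul, Finset.sum_add_distrib]
    congr 1
    rw [Finset.sum_eq_single ⟨y, hy⟩]
    · simp
    · intro b _ hb; simp [hb]
    · simp

open scoped Pointwise in
lemma IsWeylSystem.pow_mem_span [DecidableEq V] {B : Type*} [Ring B] [StarRing B] [Algebra ℂ B]
    {U : V → B} (hU : IsWeylSystem σ LinearMap.id U) (s : Finset V) {a : B}
    (ha : a ∈ Submodule.span ℂ (U '' (s : Set V))) {n : ℕ} (hn : n ≠ 0) :
    a ^ n ∈ Submodule.span ℂ (U '' (sumBox s n : Set V)) := by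
  replace hn := Nat.one_le_iff_ne_zero.2 hn
  induction n, hn using Nat.le_induction with
  | base =>
    rw [pow_one]
    refine Submodule.span_mono (Set.image_mono fun y hy => ?_) ha
    have h0 : (0 : V) ∈ sumBox s 0 := by simp [sumBox]
    simpa using add_mem_sumBox h0 hy
  | succ n hn ih =>
    rw [pow_succ]
    refine Submodule.span_mono (Set.image_mono ?_)
      (hU.mul_mem_span ih ha)
    rintro _ ⟨x, hx, y, hy, rfl⟩
    exact add_mem_sumBox hx hy

/-- A polynomial factor is invisible in the limit of the `2 ^ n`-th roots. -/
lemma le_of_forall_pow_two_pow_le {r s : ℝ} (hs : 0 ≤ s) (k : ℕ)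
    (h : ∀ n : ℕ, r ^ 2 ^ n ≤ ((2 ^ n : ℕ) + 1 : ℝ) ^ k * s ^ 2 ^ n) : r ≤ s := by
  by_contra! hlt
  rcases hs.eq_or_lt with rfl | hs
  · have := h 0
    simp at this
    linarith
  have hq : 1 < r / s := (one_lt_div hs).2 hlt
  have ht := (tendsto_pow_const_div_const_pow_of_one_lt k hq).comp (Filter.tendsto_add_atTop_nat 1)
  have ht2 := ht.comp (tendsto_pow_atTop_atTop_of_one_lt (r := 2) one_lt_two)
  obtain ⟨n, hn⟩ := (ht2.eventually_lt_const (inv_pos.2 (zero_lt_one.trans hq))).exists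
  have h1 := h n
  simp only [Function.comp_apply, Nat.cast_add, Nat.cast_one] at hn
  have hp : 0 < (r / s) ^ 2 ^ n := pow_pos (zero_lt_one.trans hq) _
  have h2 : (r / s) ^ 2 ^ n ≤ ((2 ^ n : ℕ) + 1 : ℝ) ^ k := by
    rw [div_pow, div_le_iff₀ (pow_pos hs _)]
    exact h1
  rw [pow_succ, ← div_div, div_lt_iff₀ (zero_lt_one.trans hq),
    inv_mul_cancel₀ (zero_lt_one.trans hq).ne', div_lt_one hp] at hn
  linarith

/-- A Weyl system is dominated by the Weyl algebra of a nondegenerate form. For self-adjoint `h`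
in the span of the pairs `(W x, U x)` the powers `h ^ 2 ^ n` have supports of polynomially growing
cardinality, while the norms of their components are the powers of those of `h`. -/
lemma IsWeylAlgebra.norm_snd_le {A B : Type*} [CStarAlgebra A] [CStarAlgebra B]
    {W : V → A} {U : V → B} (hσ : σ.IsAlt) (hnd : ∀ x, x ≠ 0 → ∃ y, σ y x ≠ 0)
    (hW : IsWeylAlgebra σ W) (hU : IsWeylSystem σ LinearMap.id U) {a : A × B}
    (ha : a ∈ Submodule.span ℂ (Set.range fun x => (W x, U x))) : ‖a.2‖ ≤ ‖a.1‖ := by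
  classical
  have hWU := (hW.isWeylSystem LinearMap.id).prod hU
  simp only [LinearMap.id_apply] at hWU
  have hb : star a * a ∈ Submodule.span ℂ (Set.range fun x => (W x, U x)) := by
    rw [← Set.image_univ] at ha ⊢
    exact Submodule.span_mono (Set.image_mono (Set.subset_univ _))
      (hWU.mul_mem_span (hWU.star_mem_span ha) ha)
  obtain ⟨s, hs⟩ : ∃ s : Finset V,
      star a * a ∈ Submodule.span ℂ ((fun x => (W x, U x)) '' (s : Set V)) := by
    obtain ⟨t, ht, hat⟩ := Submodule.mem_span_finite_of_mem_span hb
    obtain ⟨s, -, rfl⟩ := Finset.subset_set_image_iff.1 (by rwa [Set.image_univ] :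
      (t : Set (A × B)) ⊆ (fun x => (W x, U x)) '' Set.univ)
    exact ⟨s, by simpa using hat⟩
  have key : ‖star a.2 * a.2‖ ≤ ‖star a.1 * a.1‖ := by
    refine le_of_forall_pow_two_pow_le (norm_nonneg _) s.card fun n => ?_
    have h := hW.norm_snd_le_card_mul hσ hnd hU _
      (hWU.pow_mem_span s hs (n := 2 ^ n) (pow_ne_zero _ two_ne_zero))
    have e1 : ‖(star a.1 * a.1) ^ 2 ^ n‖ = ‖star a.1 * a.1‖ ^ 2 ^ n :=
      congrArg NNReal.toReal ((IsSelfAdjoint.star_mul_self a.1).nnnorm_pow_two_pow n)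
    have e2 : ‖(star a.2 * a.2) ^ 2 ^ n‖ = ‖star a.2 * a.2‖ ^ 2 ^ n :=
      congrArg NNReal.toReal ((IsSelfAdjoint.star_mul_self a.2).nnnorm_pow_two_pow n)
    rw [← e1, ← e2]
    refine h.trans ?_
    change _ * ‖(star a.1 * a.1) ^ 2 ^ n‖ ≤ _
    gcongr
    exact_mod_cast card_sumBox_le s (2 ^ n)
  rw [CStarRing.norm_star_mul_self, CStarRing.norm_star_mul_self] at key
  exact (mul_self_le_mul_self_iff (norm_nonneg _) (norm_nonneg _)).2 key

end Norm

/-! ### Extension of Weyl systems to the Weyl algebra -/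

section Extension

variable {V : Type*} [AddCommGroup V] [Module ℝ V] {σ : LinearMap.BilinForm ℝ V}
  {A : Type*} [CStarAlgebra A] {W : V → A}

lemma IsWeylAlgebra.adjoin_le_span (hW : IsWeylAlgebra σ W) (L : Submodule ℝ V) {a : A}
    (ha : a ∈ StarAlgebra.adjoin ℂ (W '' L)) : a ∈ Submodule.span ℂ (W '' L) := by
  classical
  have hW' := hW.isWeylSystem LinearMap.id
  simp only [LinearMap.id_apply] at hW'
  induction ha using StarAlgebra.adjoin_induction with
  | mem a h => exact Submodule.subset_span h
  | algebraMap c =>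
    rw [Algebra.algebraMap_eq_smul_one, ← hW.map_zero]
    exact Submodule.smul_mem _ _ (Submodule.subset_span ⟨0, L.zero_mem, rfl⟩)
  | add a b _ _ ha hb => exact Submodule.add_mem _ ha hb
  | mul a b _ _ ha hb =>
    refine Submodule.span_mono (Set.image_mono ?_) (hW'.mul_mem_span ha hb)
    rintro _ ⟨x, hx, y, hy, rfl⟩
    exact L.add_mem hx hy
  | star a _ ha =>
    refine Submodule.span_mono (Set.image_mono ?_) (hW'.star_mem_span ha)
    intro x hx
    exact neg_mem_iff.1 hx

lemma IsWeylAlgebra.closure_span_eq_univ (hW : IsWeylAlgebra σ W) :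
    closure (Submodule.span ℂ (Set.range W) : Set A) = Set.univ := by
  rw [Set.eq_univ_iff_forall]
  intro a
  have h : a ∈ (StarAlgebra.adjoin ℂ (Set.range W)).topologicalClosure := hW.generates ▸ trivial
  refine closure_mono (fun b hb => ?_) h
  have := hW.adjoin_le_span ⊤ (a := b) (by simpa using hb)
  simpa using this

/-- The span of a Weyl system is a *-algebra. -/
def IsWeylSystem.spanSubalgebra {B : Type*} [Ring B] [StarRing B] [Algebra ℂ B] [StarModule ℂ B]
    {U : V → B} (hU : IsWeylSystem σ LinearMap.id U) : NonUnitalStarSubalgebra ℂ B where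
  __ := Submodule.span ℂ (Set.range U)
  mul_mem' {a b} ha hb := by
    classical
    rw [← Set.image_univ] at ha hb ⊢
    exact Submodule.span_mono (Set.image_mono (Set.subset_univ _)) (hU.mul_mem_span ha hb)
  star_mem' {a} ha := by
    rw [← Set.image_univ] at ha ⊢
    exact Submodule.span_mono (Set.image_mono (Set.subset_univ _)) (hU.star_mem_span ha)

/-- The universal property of the Weyl algebra of a nondegenerate form. The closure in `A × B` of
the span of the pairs `(W x, U x)` is the graph of the homomorphism: the first projection is
isometric on it, and has a closed and dense range. -/
theorem IsWeylAlgebra.exists_nonUnitalStarAlgHom {B : Type*} [CStarAlgebra B] {U : V → B}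
    (hσ : σ.IsAlt) (hnd : ∀ x, x ≠ 0 → ∃ y, σ y x ≠ 0) (hW : IsWeylAlgebra σ W)
    (hU : IsWeylSystem σ LinearMap.id U) : ∃ π : A →⋆ₙₐ[ℂ] B, ∀ x, π (W x) = U x := by
  have hWU := (hW.isWeylSystem LinearMap.id).prod hU
  simp only [LinearMap.id_apply] at hWU
  let G : NonUnitalStarSubalgebra ℂ (A × B) := hWU.spanSubalgebra.topologicalClosure
  have hGc : IsClosed (G : Set (A × B)) :=
    NonUnitalStarSubalgebra.isClosed_topologicalClosure _
  have hmem : ∀ x, (W x, U x) ∈ G := fun x =>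
    NonUnitalStarSubalgebra.le_topologicalClosure _ (Submodule.subset_span ⟨x, rfl⟩)
  have hle : ∀ a ∈ G, ‖a.2‖ ≤ ‖a.1‖ := by
    intro a ha
    refine closure_minimal (t := {a : A × B | ‖a.2‖ ≤ ‖a.1‖}) (fun b hb => ?_)
      (isClosed_le continuous_snd.norm continuous_fst.norm) ha
    exact hW.norm_snd_le hσ hnd hU hb
  let φ : G →⋆ₙₐ[ℂ] A :=
    (NonUnitalStarAlgHom.fst ℂ A B).comp (NonUnitalStarSubalgebraClass.subtype G)
  let ψ : G →⋆ₙₐ[ℂ] B :=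
    (NonUnitalStarAlgHom.snd ℂ A B).comp (NonUnitalStarSubalgebraClass.subtype G)
  have hφ : Isometry φ := by
    refine AddMonoidHomClass.isometry_of_norm φ fun a => ?_
    exact (max_eq_left (hle a.1 a.2)).symm
  have hsurj : Function.Surjective φ := by
    have : CompleteSpace G := hGc.completeSpace_coe
    have hcl : IsClosed (Set.range φ) := hφ.isClosedEmbedding.isClosed_range
    rw [← Set.range_eq_univ, ← hcl.closure_eq, ← Set.univ_subset_iff,
      ← hW.closure_span_eq_univ]
    refine closure_mono fun a ha => ?_
    induction ha using Submodule.span_induction with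
    | mem a h => obtain ⟨x, rfl⟩ := h; exact ⟨⟨_, hmem x⟩, rfl⟩
    | zero => exact ⟨0, _root_.map_zero φ⟩
    | add a b _ _ ha hb =>
      obtain ⟨c, rfl⟩ := ha
      obtain ⟨d, rfl⟩ := hb
      exact ⟨c + d, map_add φ c d⟩
    | smul z a _ ha =>
      obtain ⟨c, rfl⟩ := ha
      exact ⟨z • c, map_smul φ z c⟩
  let e : G ≃⋆ₐ[ℂ] A := StarAlgEquiv.ofBijective φ ⟨hφ.injective, hsurj⟩
  refine ⟨ψ.comp (e.symm : A →⋆ₙₐ[ℂ] G), fun x => ?_⟩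
  have h : e.symm (W x) = ⟨_, hmem x⟩ := e.symm_apply_apply ⟨_, hmem x⟩
  change ψ (e.symm (W x)) = _
  rw [h]
  rfl

lemma NonUnitalStarAlgHom.continuous {C B : Type*} [CStarAlgebra C] [CStarAlgebra B]
    (f : C →⋆ₙₐ[ℂ] B) : Continuous f :=
  AddMonoidHomClass.continuous_of_bound f 1 fun a => by
    simpa using NonUnitalStarAlgHom.norm_apply_le f a

end Extension

/-! ### Arcs of the circle and localization of Cauchy data -/

section Localization

/-- The open arc `{exp (i θ) | a < θ < b}`, of length less than `2π`, as a proper interval. -/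
def openArc (a b : ℝ) (hab : a < b) (hba : b - a < 2 * Real.pi) : OpenProperInterval := by
  have hopen : ∀ a b : ℝ, IsOpen (Circle.exp '' Set.Ioo a b) := fun a b =>
    isLocalHomeomorph_circleExp.isOpenMap _ isOpen_Ioo
  -- The complement contains the open arc from `b` to `a + 2π`.
  refine ⟨Circle.exp '' Set.Ioo a b, hopen a b,
    ⟨⟨(Set.nonempty_Ioo.2 hab).image _,
      isPreconnected_Ioo.image _ Circle.exp.continuous.continuousOn⟩, ?_, ?_⟩⟩
  · rw [(hopen a b).interior_eq]
    exact (Set.nonempty_Ioo.2 hab).image _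
  · refine Set.Nonempty.mono (interior_maximal (t := Circle.exp '' Set.Ioo b (a + 2 * Real.pi)) ?_
      (hopen _ _)) ((Set.nonempty_Ioo.2 (by linarith)).image _)
    rintro _ ⟨s, hs, rfl⟩ ⟨t, ht, hst⟩
    have h := Circle.exp_injOn_Ico (a := a) (b := a + 2 * Real.pi) (by linarith)
      ⟨ht.1.le, by linarith [ht.2]⟩ ⟨by linarith [hs.1], hs.2⟩ hst
    linarith [hs.1, ht.2]

lemma coe_openArc (a b : ℝ) (hab : a < b) (hba : b - a < 2 * Real.pi) :
    ((openArc a b hab hba : OpenProperInterval) : Set Circle) = Circle.exp '' Set.Ioo a b := rfl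

/-- Every point of an open subset of the circle has a proper interval as a neighbourhood in it. -/
lemma exists_openProperInterval_subset {O : Set Circle} (hO : IsOpen O) {z : Circle} (hz : z ∈ O) :
    ∃ K : OpenProperInterval, z ∈ K.1 ∧ K.1 ⊆ O := by
  obtain ⟨t, rfl⟩ := Circle.exp_surjective z
  obtain ⟨ε, hε, h⟩ := Metric.isOpen_iff.1 (hO.preimage Circle.exp.continuous) t hz
  have hδ : 0 < min ε 1 := lt_min hε one_pos
  refine ⟨openArc (t - min ε 1) (t + min ε 1) (by linarith)
    (by linarith [min_le_right ε 1, Real.pi_gt_three]), ⟨t, ⟨by linarith, by linarith⟩, rfl⟩, ?_⟩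
  rw [coe_openArc, Set.image_subset_iff, ← Real.ball_eq_Ioo]
  exact (Metric.ball_subset_ball (min_le_left _ _)).trans h

/-- A cover of the circle by three proper intervals any two of which lie in a proper interval. -/
lemma exists_openProperInterval_cover : ∃ K : Fin 3 → OpenProperInterval,
    (⋃ i, (K i).1) = Set.univ ∧ ∀ i j, ∃ L, K i ≤ L ∧ K j ≤ L := by
  have hpi := Real.pi_pos
  let K : Fin 3 → OpenProperInterval := ![openArc 0 Real.pi hpi (by linarith),
    openArc (2 * Real.pi / 3) (5 * Real.pi / 3) (by linarith) (by linarith),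
    openArc (4 * Real.pi / 3) (7 * Real.pi / 3) (by linarith) (by linarith)]
  let L01 := openArc 0 (5 * Real.pi / 3) (by linarith) (by linarith)
  let L12 := openArc (2 * Real.pi / 3) (7 * Real.pi / 3) (by linarith) (by linarith)
  let L20 := openArc (4 * Real.pi / 3) (3 * Real.pi) (by linarith) (by linarith)
  have h001 : K 0 ≤ L01 := Set.image_mono (Set.Ioo_subset_Ioo (by linarith) (by linarith))
  have h101 : K 1 ≤ L01 := Set.image_mono (Set.Ioo_subset_Ioo (by linarith) (by linarith))
  have h112 : K 1 ≤ L12 := Set.image_mono (Set.Ioo_subset_Ioo (by linarith) (by linarith))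
  have h212 : K 2 ≤ L12 := Set.image_mono (Set.Ioo_subset_Ioo (by linarith) (by linarith))
  have h220 : K 2 ≤ L20 := Set.image_mono (Set.Ioo_subset_Ioo (by linarith) (by linarith))
  -- The arc `(0, π)` is also the arc `(2π, 3π)`.
  have h020 : K 0 ≤ L20 := by
    rintro _ ⟨t, ht, rfl⟩
    exact ⟨t + 2 * Real.pi, ⟨by linarith [ht.1], by linarith [ht.2]⟩, Circle.exp_add_two_pi t⟩
  refine ⟨K, ?_, ?_⟩
  · rw [Set.eq_univ_iff_forall]
    intro z
    obtain ⟨t, ⟨h0, h1⟩, rfl⟩ : ∃ t ∈ Set.Ico (Real.pi / 6) (Real.pi / 6 + 2 * Real.pi),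
        Circle.exp t = z := by
      obtain ⟨t, rfl⟩ := Circle.exp_surjective z
      obtain ⟨s, hs, he⟩ := Circle.periodic_exp.exists_mem_Ico (by positivity) t (Real.pi / 6)
      exact ⟨s, hs, he.symm⟩
    rw [Set.mem_iUnion]
    by_cases h2 : t < Real.pi
    · exact ⟨0, t, ⟨by linarith, h2⟩, rfl⟩
    · by_cases h3 : t < 5 * Real.pi / 3
      · exact ⟨1, t, ⟨by linarith, h3⟩, rfl⟩
      · exact ⟨2, t, ⟨by linarith, by linarith⟩, rfl⟩
  · intro i j
    fin_cases i <;> fin_cases j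
    exacts [⟨_, h001, h001⟩, ⟨_, h001, h101⟩, ⟨_, h020, h220⟩, ⟨_, h101, h001⟩, ⟨_, h101, h101⟩,
      ⟨_, h112, h212⟩, ⟨_, h220, h020⟩, ⟨_, h212, h112⟩, ⟨_, h212, h212⟩]

/-- Multiplication of Cauchy data by a smooth function. -/
def cutoff (f : C^∞⟮𝓡 1, Circle; 𝓘(ℝ, ℝ), ℝ⟯) : CauchyData →ₗ[ℝ] CauchyData :=
  (LinearMap.mulLeft ℝ f).prodMap (LinearMap.mulLeft ℝ f)

lemma ContMDiffMap.sum_apply_circle {ι : Type*} (s : Finset ι)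
    (f : ι → C^∞⟮𝓡 1, Circle; 𝓘(ℝ, ℝ), ℝ⟯) (z : Circle) : (∑ i ∈ s, f i) z = ∑ i ∈ s, f i z := by
  classical
  induction s using Finset.induction with
  | empty => simp
  | insert i s hi ih => rw [Finset.sum_insert hi, Finset.sum_insert hi, ← ih]; rfl

lemma cutoff_mem_localData {f : C^∞⟮𝓡 1, Circle; 𝓘(ℝ, ℝ), ℝ⟯} {I : OpenProperInterval}
    (hf : tsupport f ⊆ I.1) (x : CauchyData) : cutoff f x ∈ localData I :=
  ⟨(tsupport_mul_subset_left (f := f) (g := x.1)).trans hf,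
    (tsupport_mul_subset_left (f := f) (g := x.2)).trans hf⟩

lemma cutoff_mem_localData_of_mem (f : C^∞⟮𝓡 1, Circle; 𝓘(ℝ, ℝ), ℝ⟯) {I : OpenProperInterval}
    {x : CauchyData} (hx : x ∈ localData I) : cutoff f x ∈ localData I :=
  ⟨(tsupport_mul_subset_right (f := f) (g := x.1)).trans hx.1,
    (tsupport_mul_subset_right (f := f) (g := x.2)).trans hx.2⟩

/-- Cauchy data supported in an open set are sums of Cauchy data supported in proper intervals
contained in it. The set may be disconnected, as is the intersection of two proper intervals which
cover the circle. -/
lemma mem_iSup_localData {O : Set Circle} (hO : IsOpen O) {x : CauchyData}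
    (hx₁ : tsupport x.1 ⊆ O) (hx₂ : tsupport x.2 ⊆ O) :
    x ∈ ⨆ K : {K : OpenProperInterval // K.1 ⊆ O}, localData K.1 := by
  have hs : IsClosed (tsupport x.1 ∪ tsupport x.2) :=
    (isClosed_tsupport _).union (isClosed_tsupport _)
  obtain ⟨t, ht⟩ := hs.isCompact.elim_finite_subcover
    (fun K : {K : OpenProperInterval // K.1 ⊆ O} => K.1.1) (fun K => K.1.2.1) fun z hz => by
      obtain ⟨K, hzK, hK⟩ := exists_openProperInterval_subset hO (Set.union_subset hx₁ hx₂ hz)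
      exact Set.mem_iUnion.2 ⟨⟨K, hK⟩, hzK⟩
  obtain ⟨f, hf⟩ := SmoothPartitionOfUnity.exists_isSubordinate (𝓡 1) hs
    (fun K : t => K.1.1.1) (fun K => K.1.1.2.1) (by simpa [Set.iUnion_subtype] using ht)
  have key : ∀ g : C^∞⟮𝓡 1, Circle; 𝓘(ℝ, ℝ), ℝ⟯, tsupport g ⊆ tsupport x.1 ∪ tsupport x.2 →
      ∀ z, ∑ K : t, f K z * g z = g z := by
    intro g hg z
    rw [← Finset.sum_mul]
    by_cases hz : z ∈ tsupport g
    · have h := f.sum_eq_one (hg hz)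
      rw [finsum_eq_sum_of_fintype] at h
      rw [h, one_mul]
    · rw [image_eq_zero_of_notMem_tsupport hz, mul_zero]
  have hsum : ∑ K : t, cutoff (f K) x = x := by
    refine Prod.ext ?_ ?_
    · rw [Prod.fst_sum]
      ext z
      rw [← key x.1 Set.subset_union_left z]
      simp [cutoff, ContMDiffMap.sum_apply_circle]
    · rw [Prod.snd_sum]
      ext z
      rw [← key x.2 Set.subset_union_right z]
      simp [cutoff, ContMDiffMap.sum_apply_circle]
  rw [← hsum]
  exact Submodule.sum_mem _ fun K _ =>
    Submodule.mem_iSup_of_mem K.1 (cutoff_mem_localData (hf K) x)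

/-- A smooth partition of unity subordinate to a finite cover, as a decomposition of Cauchy data. -/
lemma exists_cutoff {n : ℕ} (K : Fin n → OpenProperInterval) (hK : (⋃ i, (K i).1) = Set.univ) :
    ∃ f : Fin n → C^∞⟮𝓡 1, Circle; 𝓘(ℝ, ℝ), ℝ⟯, (∀ i, tsupport (f i) ⊆ (K i).1) ∧
      ∑ i, cutoff (f i) = LinearMap.id := by
  obtain ⟨f, hf⟩ := SmoothPartitionOfUnity.exists_isSubordinate (𝓡 1) isClosed_univ
    (fun i => (K i).1) (fun i => (K i).2.1) hK.ge
  refine ⟨f, hf, ?_⟩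
  have h1 : ∑ i, f i = 1 := by
    ext z
    have h := f.sum_eq_one (Set.mem_univ z)
    rw [finsum_eq_sum_of_fintype] at h
    rw [ContMDiffMap.sum_apply_circle, h]
    rfl
  refine LinearMap.ext fun x => ?_
  rw [LinearMap.sum_apply]
  refine Prod.ext ?_ ?_
  · rw [Prod.fst_sum]
    change ∑ i, f i * x.1 = x.1
    rw [← Finset.sum_mul, h1, one_mul]
  · rw [Prod.snd_sum]
    change ∑ i, f i * x.2 = x.2
    rw [← Finset.sum_mul, h1, one_mul]

/-- The form is nondegenerate: `σ((-Π, Φ), (Φ, Π)) = ∫ (Φ² + Π²) dθ`. -/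
lemma symplecticForm_nondegenerate (x : CauchyData) (hx : x ≠ 0) :
    ∃ y, symplecticForm y x ≠ 0 := by
  refine ⟨(-x.2, x.1), ?_⟩
  intro h
  have hc : ∀ f : C^∞⟮𝓡 1, Circle; 𝓘(ℝ, ℝ), ℝ⟯, Continuous fun θ : ℝ => f (Circle.exp θ) :=
    fun f => f.contMDiff.continuous.comp Circle.exp.continuous
  have h' : ∫ θ in (-Real.pi)..Real.pi,
      (x.1 (Circle.exp θ) ^ 2 + x.2 (Circle.exp θ) ^ 2) = 0 := by
    rw [← h]
    change _ = ∫ θ in (-Real.pi)..Real.pi, (x.1 (Circle.exp θ) * x.1 (Circle.exp θ) -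
      (-x.2 (Circle.exp θ)) * x.2 (Circle.exp θ))
    congr 1; funext θ; ring
  apply hx
  have hle : -Real.pi < Real.pi := by linarith [Real.pi_pos]
  have hnn : ∀ θ : ℝ, 0 ≤ x.1 (Circle.exp θ) ^ 2 + x.2 (Circle.exp θ) ^ 2 := fun θ =>
    add_nonneg (sq_nonneg _) (sq_nonneg _)
  have hz : ∀ θ ∈ Set.Icc (-Real.pi) Real.pi,
      x.1 (Circle.exp θ) ^ 2 + x.2 (Circle.exp θ) ^ 2 = 0 := by
    by_contra! hne
    obtain ⟨c, hcI, hcne⟩ := hne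
    have hpos := intervalIntegral.integral_pos hle
      (((hc x.1).pow 2).add ((hc x.2).pow 2)).continuousOn
      (fun θ _ => hnn θ) ⟨c, hcI, lt_of_le_of_ne (hnn c) hcne.symm⟩
    exact hpos.ne' h'
  have hz' : ∀ z, x.1 z ^ 2 + x.2 z ^ 2 = 0 := by
    intro z
    have := hz _ ⟨(Complex.neg_pi_lt_arg (z : ℂ)).le, Complex.arg_le_pi _⟩
    rwa [Circle.exp_arg] at this
  refine Prod.ext ?_ ?_ <;> ext z <;>
    simp only [Prod.fst_zero, Prod.snd_zero, ContMDiffMap.coe_zero, Pi.zero_apply] <;>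
    nlinarith [hz' z, sq_nonneg (x.1 z), sq_nonneg (x.2 z)]

end Localization

/-! ### Gluing local representations -/

section Gluing

lemma IsWeylSystem.comp {V E E' : Type*} [AddCommGroup V] [Module ℝ V] [AddCommGroup E]
    [Module ℝ E] [AddCommGroup E'] [Module ℝ E'] {σ : LinearMap.BilinForm ℝ V} {p : E →ₗ[ℝ] V}
    {B C : Type*} [CStarAlgebra B] [CStarAlgebra C] {U : E → B} (hU : IsWeylSystem σ p U)
    (f : B →⋆ₙₐ[ℂ] C) (e : E' →ₗ[ℝ] E) : IsWeylSystem σ (p ∘ₗ e) (fun x => f (U (e x))) where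
  map_neg x := by rw [_root_.map_neg, hU.map_neg, map_star]
  mul x y := by rw [← map_mul, hU.mul, map_smul, map_add]; rfl

variable {A : Type u} [CStarAlgebra A] {W : CauchyData → A}

/-- The generators `W x` of `𝒲(I)`, for `x` supported in `I`. -/
def localGenerator (W : CauchyData → A) (I : OpenProperInterval) (x : localData I) :
    (weylPrecosheaf W).alg I :=
  (⟨W x, StarSubalgebra.le_topologicalClosure _ (StarAlgebra.subset_adjoin ℂ _ ⟨x, x.2, rfl⟩)⟩ :
    localWeylAlgebra W I)

lemma isWeylSystem_localGenerator (hW : IsWeylAlgebra symplecticForm W) (I : OpenProperInterval) :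
    IsWeylSystem symplecticForm (localData I).subtype (localGenerator W I) where
  map_neg x := Subtype.ext (hW.map_neg x)
  mul x y := Subtype.ext (hW.mul x y)

lemma weylEmbedding_localGenerator (I : OpenProperInterval) (x : localData I) :
    weylEmbedding W I (localGenerator W I x) = W x := rfl

/-- Homomorphisms on `𝒲(I)` are determined by their values on the generators. -/
lemma localWeylAlgebra_hom_ext (hW : IsWeylAlgebra symplecticForm W) {I : OpenProperInterval}
    {B : Type*} [CStarAlgebra B] {f g : (weylPrecosheaf W).alg I →⋆ₙₐ[ℂ] B}
    (h : ∀ x, f (localGenerator W I x) = g (localGenerator W I x)) : f = g := by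
  refine NonUnitalStarAlgHom.ext fun a => ?_
  have hcl : IsClosed {a | f a = g a} := isClosed_eq f.continuous g.continuous
  have hspan : ∀ b ∈ Submodule.span ℂ (W '' (localData I : Set CauchyData)),
      ∃ c : (weylPrecosheaf W).alg I, f c = g c ∧ weylEmbedding W I c = b := by
    intro b hb
    induction hb using Submodule.span_induction with
    | mem b hb => obtain ⟨x, hx, rfl⟩ := hb; exact ⟨localGenerator W I ⟨x, hx⟩, h _, rfl⟩
    | zero => exact ⟨0, by rw [map_zero, map_zero], map_zero _⟩
    | add b b' _ _ hb hb' =>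
      obtain ⟨c, hc, rfl⟩ := hb
      obtain ⟨c', hc', rfl⟩ := hb'
      exact ⟨c + c', by rw [map_add, map_add, hc, hc'], map_add _ _ _⟩
    | smul z b _ hb =>
      obtain ⟨c, hc, rfl⟩ := hb
      exact ⟨z • c, by rw [map_smul, map_smul, hc], map_smul _ _ _⟩
  have ha : a ∈ closure {a | f a = g a} := by
    refine (closure_subtype (p := fun a => a ∈ localWeylAlgebra W I)).2 ?_
    refine closure_mono (fun b hb => ?_) a.2
    obtain ⟨c, hc, rfl⟩ := hspan b (hW.adjoin_le_span _ hb)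
    exact ⟨c, hc, rfl⟩
  rwa [hcl.closure_eq] at ha

variable {B : Type*} [CStarAlgebra B] {ρ : ∀ I, (weylPrecosheaf W).alg I →⋆ₙₐ[ℂ] B}

/-- The projections `ρ_I(1)` coincide, because any two proper intervals are linked by a chain of
inclusions. -/
lemma localRep_zero_eq
    (hρ : ∀ {I J : OpenProperInterval} (h : I ≤ J) (a : (weylPrecosheaf W).alg I),
      ρ J ((weylPrecosheaf W).incl h a) = ρ I a)
    (I J : OpenProperInterval) :
    ρ I (localGenerator W I 0) = ρ J (localGenerator W J 0) := by
  have hle : ∀ {I J : OpenProperInterval}, I ≤ J →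
      ρ J (localGenerator W J 0) = ρ I (localGenerator W I 0) := fun {I J} h =>
    hρ h (localGenerator W I 0)
  obtain ⟨K, hK, hL⟩ := exists_openProperInterval_cover
  have h : ∀ I, ∃ i, ρ I (localGenerator W I 0) = ρ (K i) (localGenerator W (K i) 0) := by
    intro I
    obtain ⟨z, hz⟩ := I.2.2.1.nonempty
    obtain ⟨i, hi⟩ := Set.mem_iUnion.1 (hK.ge (Set.mem_univ z))
    obtain ⟨M, -, hM⟩ := exists_openProperInterval_subset (I.2.1.inter (K i).2.1) ⟨hz, hi⟩
    have h1 : M ≤ I := hM.trans Set.inter_subset_left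
    have h2 : M ≤ K i := hM.trans Set.inter_subset_right
    exact ⟨i, (hle h1).trans (hle h2).symm⟩
  obtain ⟨i, hi⟩ := h I
  obtain ⟨j, hj⟩ := h J
  obtain ⟨L, hiL, hjL⟩ := hL i j
  rw [hi, hj, ← hle hiL, ← hle hjL]

/-- The local representations of `W x` coincide, on all proper intervals in which `x` is
supported. -/
lemma localRep_eq (hW : IsWeylAlgebra symplecticForm W)
    (hρ : ∀ {I J : OpenProperInterval} (h : I ≤ J) (a : (weylPrecosheaf W).alg I),
      ρ J ((weylPrecosheaf W).incl h a) = ρ I a)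
    {I J : OpenProperInterval} {x : CauchyData} (hI : x ∈ localData I) (hJ : x ∈ localData J) :
    ρ I (localGenerator W I ⟨x, hI⟩) = ρ J (localGenerator W J ⟨x, hJ⟩) := by
  have hadd : ∀ (I : OpenProperInterval) (x y : localData I), ρ I (localGenerator W I (x + y)) =
      Complex.exp (-(Complex.I * (symplecticForm x.1 y.1 : ℂ) / 2)) •
        (ρ I (localGenerator W I x) * ρ I (localGenerator W I y)) := by
    intro I x y
    rw [← map_mul, (isWeylSystem_localGenerator hW I).mul, map_smul, smul_smul, ← Complex.exp_add]
    simp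
  suffices h : ∃ hI hJ, ρ I (localGenerator W I ⟨x, hI⟩) = ρ J (localGenerator W J ⟨x, hJ⟩) from
    h.2.2
  refine Submodule.iSup_induction _ (motive := fun x => ∃ hI hJ,
    ρ I (localGenerator W I ⟨x, hI⟩) = ρ J (localGenerator W J ⟨x, hJ⟩))
    (mem_iSup_localData (I.2.1.inter J.2.1) (Set.subset_inter hI.1 hJ.1)
      (Set.subset_inter hI.2 hJ.2)) ?_ ?_ ?_
  · rintro ⟨K, hK⟩ y hy
    have h1 : K ≤ I := hK.trans Set.inter_subset_left
    have h2 : K ≤ J := hK.trans Set.inter_subset_right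
    refine ⟨⟨hy.1.trans h1, hy.2.trans h1⟩, ⟨hy.1.trans h2, hy.2.trans h2⟩, ?_⟩
    exact (hρ h1 (localGenerator W K ⟨y, hy⟩)).trans (hρ h2 (localGenerator W K ⟨y, hy⟩)).symm
  · exact ⟨Submodule.zero_mem _, Submodule.zero_mem _, localRep_zero_eq hρ I J⟩
  · rintro y z ⟨hyI, hyJ, hy⟩ ⟨hzI, hzJ, hz⟩
    refine ⟨Submodule.add_mem _ hyI hzI, Submodule.add_mem _ hyJ hzJ, ?_⟩
    have h1 := hadd I ⟨y, hyI⟩ ⟨z, hzI⟩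
    have h2 := hadd J ⟨y, hyJ⟩ ⟨z, hzJ⟩
    rw [hy, hz] at h1
    exact h1.trans h2.symm

/-- A compatible family of local representations comes from a global Weyl system. With the cutoffs
`x₀, x₁, x₂` of `x` to three proper intervals, any two of which lie in a proper interval, its value
at `x` is the product of the local representations of `W x₀`, `W x₁` and `W x₂`, multiplied by the
phase which is required by the Weyl relations. -/
lemma exists_weylSystem_extending (hW : IsWeylAlgebra symplecticForm W)
    (hρ : ∀ {I J : OpenProperInterval} (h : I ≤ J) (a : (weylPrecosheaf W).alg I),
      ρ J ((weylPrecosheaf W).incl h a) = ρ I a) :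
    ∃ U : CauchyData → B, IsWeylSystem symplecticForm LinearMap.id U ∧
      ∀ I (x : localData I), U x = ρ I (localGenerator W I x) := by
  obtain ⟨K, hK, hL⟩ := exists_openProperInterval_cover
  obtain ⟨f, hf, hsum⟩ := exists_cutoff K hK
  have hσ := symplecticForm_isAlt
  let p : Fin 3 → CauchyData →ₗ[ℝ] CauchyData := fun i => cutoff (f i)
  let e : ∀ i, CauchyData →ₗ[ℝ] localData (K i) := fun i =>
    (p i).codRestrict _ (cutoff_mem_localData (hf i))
  let T : Fin 3 → CauchyData → B := fun i x => ρ (K i) (localGenerator W (K i) (e i x))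
  have hT : ∀ i, IsWeylSystem symplecticForm (p i) (T i) := fun i =>
    (isWeylSystem_localGenerator hW (K i)).comp (ρ (K i)) (e i)
  have hcomm : ∀ i j x y, T i x * T j y =
      Complex.exp (Complex.I * (symplecticForm (p i x) (p j y) : ℂ)) • (T j y * T i x) := by
    intro i j x y
    obtain ⟨L, hi, hj⟩ := hL i j
    have hx : p i x ∈ localData L :=
      cutoff_mem_localData ((hf i).trans hi) x
    have hy : p j y ∈ localData L :=
      cutoff_mem_localData ((hf j).trans hj) y
    have h1 : T i x = ρ L (localGenerator W L ⟨p i x, hx⟩) := localRep_eq hW hρ _ hx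
    have h2 : T j y = ρ L (localGenerator W L ⟨p j y, hy⟩) := localRep_eq hW hρ _ hy
    rw [h1, h2, ← map_mul, (isWeylSystem_localGenerator hW L).commute hσ, map_smul, map_mul]
    rfl
  have hp : p 0 + p 1 + p 2 = LinearMap.id := by rw [← hsum, Fin.sum_univ_three]
  refine ⟨weylGlue symplecticForm (p 0 + p 1) (p 2)
    (weylGlue symplecticForm (p 0) (p 1) (T 0) (T 1)) (T 2), ?_, ?_⟩
  · rw [← hp]
    exact ((hT 0).glue hσ (hT 1) (hcomm 0 1)).glue hσ (hT 2)
      (weylGlue_commute (hcomm 0 2) (hcomm 1 2))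
  · intro I x
    have hx : ∀ i, p i x ∈ localData I := fun i => cutoff_mem_localData_of_mem (f i) x.2
    have h : ∀ i, T i x = ρ I (localGenerator W I ⟨p i x, hx i⟩) := fun i =>
      localRep_eq hW hρ _ (hx i)
    -- The same product of elements of `𝒲(I)` is `W x`.
    have hWx : localGenerator W I x =
        Complex.exp (-(Complex.I * (symplecticForm ((p 0 + p 1) x) (p 2 x) : ℂ) / 2)) •
          (Complex.exp (-(Complex.I * (symplecticForm (p 0 x) (p 1 x) : ℂ) / 2)) •
            (localGenerator W I ⟨p 0 x, hx 0⟩ * localGenerator W I ⟨p 1 x, hx 1⟩) *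
              localGenerator W I ⟨p 2 x, hx 2⟩) := by
      have hinj : Function.Injective (weylEmbedding W I) := Subtype.val_injective
      apply hinj
      have h01 := hW.weylGlue (p 0) (p 1) (x : CauchyData)
      have h012 := hW.weylGlue (p 0 + p 1) (p 2) (x : CauchyData)
      rw [hp, LinearMap.id_apply] at h012
      simp only [weylGlue] at h01 h012
      simp only [map_smul, map_mul, weylEmbedding_localGenerator]
      rw [h01, h012]
    rw [hWx]
    simp only [weylGlue, h, map_smul, map_mul]

lemma mem_adjoin_iUnion_weylEmbedding (hW : IsWeylAlgebra symplecticForm W) (x : CauchyData) :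
    W x ∈ StarAlgebra.adjoin ℂ (⋃ I, Set.range (weylEmbedding W I)) := by
  refine Submodule.iSup_induction _ (motive := fun x =>
    W x ∈ StarAlgebra.adjoin ℂ (⋃ I, Set.range (weylEmbedding W I)))
    (mem_iSup_localData isOpen_univ (x := x) (Set.subset_univ _) (Set.subset_univ _)) ?_ ?_ ?_
  · rintro ⟨I, h⟩ y hy
    exact StarAlgebra.subset_adjoin ℂ _ (Set.mem_iUnion.2 ⟨I, localGenerator W I ⟨y, hy⟩, rfl⟩)
  · rw [hW.map_zero]
    exact one_mem _
  · intro y z hy hz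
    have h := hW.mul y z
    have h' : W (y + z) =
        Complex.exp (-(Complex.I * (symplecticForm y z : ℂ) / 2)) • (W y * W z) := by
      rw [h, smul_smul, ← Complex.exp_add, neg_add_cancel, Complex.exp_zero, one_smul]
    rw [h']
    exact (StarAlgebra.adjoin ℂ _).smul_mem (mul_mem hy hz) _

lemma CStarPrecosheaf.ofSubalgebrasEmb_incl {ι : Type w} [PartialOrder ι]
    (S : ι → StarSubalgebra ℂ A) (hS : ∀ i, IsClosed (S i : Set A)) (hmono : Monotone S) {i j : ι}
    (h : i ≤ j) (a : (ofSubalgebras S hS hmono).alg i) :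
    ofSubalgebrasEmb S hS hmono j ((ofSubalgebras S hS hmono).incl h a) =
      ofSubalgebrasEmb S hS hmono i a :=
  rfl

lemma weylEmbedding_generates (hW : IsWeylAlgebra symplecticForm W) :
    (StarAlgebra.adjoin ℂ (⋃ I, Set.range (weylEmbedding W I))).topologicalClosure = ⊤ := by
  rw [eq_top_iff, ← hW.generates]
  refine StarSubalgebra.topologicalClosure_mono (StarAlgebra.adjoin_le ?_)
  rintro _ ⟨x, rfl⟩
  exact mem_adjoin_iUnion_weylEmbedding hW x

/-- Uniqueness in the universal property. -/
lemma hom_ext_of_weylEmbedding (hW : IsWeylAlgebra symplecticForm W) {f g : A →⋆ₙₐ[ℂ] B}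
    (h : ∀ I a, f (weylEmbedding W I a) = g (weylEmbedding W I a)) : f = g := by
  refine NonUnitalStarAlgHom.ext fun a => ?_
  have ha : a ∈ (StarAlgebra.adjoin ℂ (⋃ I, Set.range (weylEmbedding W I))).topologicalClosure :=
    weylEmbedding_generates hW ▸ trivial
  refine closure_minimal (fun b hb => ?_) (isClosed_eq f.continuous g.continuous) ha
  induction hb using StarAlgebra.adjoin_induction with
  | mem b hb =>
    obtain ⟨I, c, rfl⟩ := Set.mem_iUnion.1 hb
    exact h I c
  | algebraMap z =>
    -- The homomorphisms need not be unital, but the unit is that of any `𝒲(I)`.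
    obtain ⟨I, -, -⟩ := exists_openProperInterval_subset isOpen_univ (Set.mem_univ 1)
    have h1 := h I 1
    rw [map_one] at h1
    simp only [Set.mem_ofPred_eq, Algebra.algebraMap_eq_smul_one, map_smul, h1]
  | add b c _ _ hb hc =>
    exact (map_add f b c).trans ((congrArg₂ _ hb hc).trans (map_add g b c).symm)
  | mul b c _ _ hb hc =>
    exact (map_mul f b c).trans ((congrArg₂ _ hb hc).trans (map_mul g b c).symm)
  | star b _ hb => exact (map_star f b).trans ((congrArg _ hb).trans (map_star g b).symm)

/-- The universal property: a compatible family of representations of the local Weyl algebras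
extends uniquely to the Weyl algebra. -/
theorem existsUnique_extending (hW : IsWeylAlgebra symplecticForm W)
    (hρ : ∀ {I J : OpenProperInterval} (h : I ≤ J) (a : (weylPrecosheaf W).alg I),
      ρ J ((weylPrecosheaf W).incl h a) = ρ I a) :
    ∃! π : A →⋆ₙₐ[ℂ] B, ∀ I a, π (weylEmbedding W I a) = ρ I a := by
  obtain ⟨U, hU, hUρ⟩ := exists_weylSystem_extending hW hρ
  obtain ⟨π, hπ⟩ := hW.exists_nonUnitalStarAlgHom symplecticForm_isAlt
    symplecticForm_nondegenerate hU
  have hext : ∀ I a, π (weylEmbedding W I a) = ρ I a := by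
    intro I
    let ι : (weylPrecosheaf W).alg I →⋆ₙₐ[ℂ] A := (weylEmbedding W I).toNonUnitalStarAlgHom
    have h : π.comp ι = ρ I :=
      localWeylAlgebra_hom_ext hW fun x => (hπ x).trans (hUρ I x)
    exact DFunLike.congr_fun h
  exact ⟨π, hext, fun π' hπ' => hom_ext_of_weylEmbedding hW fun I a =>
    (hπ' I a).trans (hext I a).symm⟩

end Gluing

end

theorem mainTheorem9 {𝒲 : Type u} [CStarAlgebra 𝒲] (W : CauchyData → 𝒲)
    (hW : IsWeylAlgebra symplecticForm W) :
    IsUniversalAlgebra.{u, v} (weylPrecosheaf W) (weylEmbedding W) where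
  emb_injective _ := Subtype.val_injective
  emb_incl h a := CStarPrecosheaf.ofSubalgebrasEmb_incl _ _ _ h a
  generates := weylEmbedding_generates hW
  existsUnique_rep _ _ _ _ _ hρ := existsUnique_extending hW hρ
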